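/- Let $\gamma>3$ and let $\psi(x)=x^{-1/(\gamma-1)}$ for $0<x\le 1$. For $\theta\ge 0$ and $n\ge 1$, the Chung–Lu graph is the random graph on the vertex set $\{1,\dots,n\}$ in which distinct vertices $i,j$ are joined by an edge, independently over all unordered pairs, with probability $$p(i,j)=\min\Bigl\{1,\ \frac{\theta\,\psi(i/n)\,\psi(j/n)}{n}\Bigr\}.$$ (For fixed $\gamma$ and $\theta$ the minimum with $1$ plays no role once $n$ is large.) Let $\mathcal C_v$ denote the cluster (connected component) of the vertex $v$, and let $$\theta_c=\frac{1}{\int_0^1\psi(x)^2\,dx}>0 .$$ Then for every $\theta$ with $0\le\theta<\theta_c$ there is a constant $C=C(\gamma,\theta)$ such that $$P\Bigl(\max_{v}|\mathcal C_v|\ \ge\ C\,n^{1/(\gamma-1)}\Bigr)\longrightarrow 0\qquad\text{as } n\to\infty .$$ -/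

import Mathlib

noncomputable section

namespace ChungLu

open MeasureTheory

/-- The weight function `ψ(x) = x ^ (-1/(γ-1))` on `(0, 1]`. -/
def psi (γ x : ℝ) : ℝ := x ^ (-(1 / (γ - 1)))

/-- The rank-one kernel `κ(x, y) = θ ψ(x) ψ(y)`. -/
def kernel (γ θ x y : ℝ) : ℝ := θ * psi γ x * psi γ y

/-- The critical value `θ_c = 1 / ∫₀¹ ψ(x)² dx` (the integral is finite when `γ > 3`). -/
def thetaC (γ : ℝ) : ℝ := 1 / ∫ x in (0 : ℝ)..1, psi γ x ^ 2

/-- `Fin n` is `{0, …, n-1}`, so its element `i` stands for the vertex `i + 1` of `{1, …, n}`,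
whose label is `(i + 1) / n ∈ (0, 1]`. -/
def label (n : ℕ) (i : Fin n) : ℝ := ((i : ℕ) + 1 : ℝ) / n

/-- The edge probability `κ(i/n, j/n) / n` of the unordered pair `s(i, j)`, cut off to `[0, 1]`. -/
def edgeProb (γ θ : ℝ) (n : ℕ) : Sym2 (Fin n) → unitInterval :=
  Sym2.lift ⟨fun i j => Set.projIcc (0 : ℝ) 1 zero_le_one
      (kernel γ θ (label n i) (label n j) / n), by
    intro i j
    have h : kernel γ θ (label n i) (label n j) = kernel γ θ (label n j) (label n i) := by
      unfold kernel; ring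
    simp only [h]⟩

/-- The probability measure under which the coins of the unordered pairs `e` are independent and
the coin of `e` shows `true` with probability `edgeProb γ θ n e`. -/
def coinMeasure (γ θ : ℝ) (n : ℕ) : Measure (Sym2 (Fin n) → Bool) :=
  Measure.pi fun e => ProbabilityTheory.bernoulliMeasure true false (edgeProb γ θ n e)

/-- The Chung–Lu random graph: distinct `i`, `j` are adjacent when the coin of `s(i, j)` shows
`true`. (The coins of the diagonal pairs are not used; loops do not matter for clusters.) -/
def graph {n : ℕ} (ω : Sym2 (Fin n) → Bool) : SimpleGraph (Fin n) :=
  SimpleGraph.fromEdgeSet {e | ω e = true}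

/-- The size of the cluster (connected component) of the vertex `v`. -/
def clusterSize {n : ℕ} (G : SimpleGraph (Fin n)) (v : Fin n) : ℕ :=
  {w : Fin n | G.Reachable v w}.ncard

/-- The size of the largest cluster. -/
def maxClusterSize {n : ℕ} (G : SimpleGraph (Fin n)) : ℕ :=
  Finset.univ.sup fun v => clusterSize G v

end ChungLu

end

open MeasureTheory

namespace ChungLu

/-! Write `α = 1/(γ-1)`, so `2α < 1`, and `ρ₀ = θ/θ_c < 1`. Revealing boundary coins one at a time
turns suitable potentials into supermartingales (`integral_cluster_le`). A linear potential bounds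
the probability that `x` and `z` are connected by `O(w_x w_z / n)`. An exponential potential bounds
the exponential moment of a cluster. The heaviest weights, up to `n^α`, forbid a useful exponential
moment for whole clusters, so the at most `n^ε` heaviest vertices are declared hubs. Two hubs are
connected with probability `O(n^(2ε+2α-1))`, which vanishes for small `ε`. Otherwise every cluster
contains at most one hub and is found by exploring from a single root without the other hubs
(`connects_hubs_or_subset_hubFree`). All newly found vertices are then light, the exponential moment
is controlled by the root alone, and Markov's inequality with a union bound over roots finishes
(`measureReal_exists_card_cluster_le`). -/

/-! ### Product measures and resampling one coin. -/

/-- Resampling one coordinate leaves a finite product of probability measures unchanged. -/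
theorem measurePreserving_update {ι : Type*} [Fintype ι] [DecidableEq ι] {α : Type*} [MeasurableSpace α]
    (μ : ι → Measure α) [∀ i, IsProbabilityMeasure (μ i)] (i : ι) :
    MeasurePreserving (fun z : α × (ι → α) => Function.update z.2 i z.1)
      ((μ i).prod (Measure.pi μ)) (Measure.pi μ) := by
  have hm : Measurable (fun z : α × (ι → α) => Function.update z.2 i z.1) := by
    rw [measurable_pi_iff]
    intro j
    by_cases h : j = i
    · subst h; simpa using measurable_fst
    · simp only [Function.update_of_ne h]
      exact (measurable_pi_apply j).comp measurable_snd
  refine ⟨hm, ?_⟩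
  symm
  refine Measure.pi_eq fun s hs => ?_
  rw [Measure.map_apply hm (MeasurableSet.univ_pi hs)]
  have hpre : (fun z : α × (ι → α) => Function.update z.2 i z.1) ⁻¹' (Set.univ.pi s) =
      s i ×ˢ Set.univ.pi (Function.update s i Set.univ) := by
    ext z
    simp only [Set.mem_preimage, Set.mem_univ_pi, Set.mem_prod]
    constructor
    · intro h
      refine ⟨by simpa using h i, fun j => ?_⟩
      by_cases hj : j = i
      · subst hj; simp
      · simpa [hj] using h j
    · rintro ⟨h₁, h₂⟩ j
      by_cases hj : j = i
      · subst hj; simpa using h₁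
      · simpa [hj] using h₂ j
  rw [hpre, Measure.prod_prod, Measure.pi_pi, ← Finset.mul_prod_erase _ _ (Finset.mem_univ i),
    ← Finset.mul_prod_erase _ (fun j => μ j (s j)) (Finset.mem_univ i)]
  simp only [Function.update_self, measure_univ, one_mul]
  congr 1
  refine Finset.prod_congr rfl fun j hj => ?_
  rw [Function.update_of_ne (Finset.ne_of_mem_erase hj)]

/-- The law of independent coins, the coin `e` showing `true` with probability `p e`. -/
noncomputable def coins {ι : Type*} [Fintype ι] (p : ι → unitInterval) : Measure (ι → Bool) :=
  Measure.pi fun e => ProbabilityTheory.bernoulliMeasure true false (p e)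

instance {ι : Type*} [Fintype ι] (p : ι → unitInterval) : IsProbabilityMeasure (coins p) := by
  unfold coins; infer_instance

/-- This plays the role of conditioning on the coin of `e`: after the update the integrands no
longer depend on `ω e`, so the same product measure serves at every stage of the exploration. -/
theorem integral_coins_eq {ι : Type*} [Fintype ι] [DecidableEq ι] (p : ι → unitInterval) (e : ι)
    (f : (ι → Bool) → ℝ) :
    ∫ ω, f ω ∂coins p = (p e : ℝ) * ∫ ω, f (Function.update ω e true) ∂coins p +
      (1 - (p e : ℝ)) * ∫ ω, f (Function.update ω e false) ∂coins p := by
  have h := measurePreserving_update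
    (fun e => ProbabilityTheory.bernoulliMeasure true false (p e)) e
  have h1 : ∫ ω, f ω ∂coins p = ∫ z, f (Function.update z.2 e z.1)
      ∂((ProbabilityTheory.bernoulliMeasure true false (p e)).prod (coins p)) := by
    unfold coins
    conv_lhs => rw [← h.map_eq]
    exact integral_map h.measurable.aemeasurable (Measurable.of_discrete).aestronglyMeasurable
  rw [h1, integral_prod _ .of_finite, ProbabilityTheory.integral_bernoulliMeasure]
  simp

/-! ### Exploring a cluster coin by coin. -/

/-- The graph of the pairs in `D` whose coin shows `true`. -/
def openGraph {V : Type*} (D : Finset (Sym2 V)) (ω : Sym2 V → Bool) : SimpleGraph V :=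
  SimpleGraph.fromEdgeSet {e | e ∈ D ∧ ω e = true}

open Classical in
/-- The set of vertices that can be reached from `A` along open pairs in `D`. -/
noncomputable def cluster {V : Type*} [Fintype V] (D : Finset (Sym2 V)) (ω : Sym2 V → Bool) (A : Finset V) :
    Finset V :=
  {w | ∃ v ∈ A, (openGraph D ω).Reachable v w}

section Cluster

variable {V : Type*} {D : Finset (Sym2 V)} {ω : Sym2 V → Bool} {A : Finset V}

theorem openGraph_adj {v w : V} :
    (openGraph D ω).Adj v w ↔ (s(v, w) ∈ D ∧ ω s(v, w) = true) ∧ v ≠ w := by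
  simp [openGraph]

theorem mem_of_reachable {G : SimpleGraph V} {S : Finset V}
    (hS : ∀ a ∈ S, ∀ b, G.Adj a b → b ∈ S) {v w : V} (hv : v ∈ S) (h : G.Reachable v w) :
    w ∈ S := by
  rw [SimpleGraph.reachable_iff_reflTransGen] at h
  induction h with
  | refl => exact hv
  | tail _ hab ih => exact hS _ ih _ hab

variable [Fintype V]

theorem mem_cluster {w : V} : w ∈ cluster D ω A ↔ ∃ v ∈ A, (openGraph D ω).Reachable v w := by
  simp [cluster]

theorem subset_cluster : A ⊆ cluster D ω A :=
  fun v hv => mem_cluster.2 ⟨v, hv, .refl v⟩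

theorem cluster_subset {S : Finset V} (hA : A ⊆ S)
    (hS : ∀ a ∈ S, ∀ b, (openGraph D ω).Adj a b → b ∈ S) : cluster D ω A ⊆ S := by
  intro w hw
  obtain ⟨v, hv, h⟩ := mem_cluster.1 hw
  exact mem_of_reachable hS (hA hv) h

theorem mem_cluster_of_adj {a b : V} (ha : a ∈ cluster D ω A) (h : (openGraph D ω).Adj a b) :
    b ∈ cluster D ω A := by
  obtain ⟨v, hv, h'⟩ := mem_cluster.1 ha
  exact mem_cluster.2 ⟨v, hv, h'.trans h.reachable⟩

theorem cluster_eq_self (h : ∀ i ∈ A, ∀ j ∉ A, s(i, j) ∉ D) : cluster D ω A = A := by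
  refine (cluster_subset subset_rfl fun a ha b hab => ?_).antisymm subset_cluster
  by_contra hb
  exact h a ha b hb (openGraph_adj.1 hab).1.1

-- Once `j` belongs to the explored set, the pair joining it to `i` connects nothing new and can be
-- discarded.
open Classical in
theorem cluster_update_true {i j : V} (hi : i ∈ A) (hj : j ∉ A) (he : s(i, j) ∈ D) :
    cluster D (Function.update ω s(i, j) true) A =
      cluster (D.erase s(i, j)) ω (insert j A) := by
  have hij : i ≠ j := fun h => hj (h ▸ hi)
  apply Finset.Subset.antisymm
  · refine cluster_subset ((Finset.subset_insert _ _).trans subset_cluster) fun a ha b hab => ?_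
    rw [openGraph_adj] at hab
    by_cases hf : s(a, b) = s(i, j)
    · apply subset_cluster
      rcases Sym2.eq_iff.1 hf with ⟨_, rfl⟩ | ⟨_, rfl⟩ <;> simp [hi]
    · refine mem_cluster_of_adj ha ?_
      rw [Function.update_of_ne hf] at hab
      simp [openGraph_adj, hf, hab]
  · have hA : A ⊆ cluster D (Function.update ω s(i, j) true) A := subset_cluster
    refine cluster_subset (Finset.insert_subset ?_ hA) fun a ha b hab => ?_
    · exact mem_cluster_of_adj (hA hi) (by simp [openGraph_adj, he, hij])
    · refine mem_cluster_of_adj ha ?_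
      rw [openGraph_adj, Finset.mem_erase] at hab
      rw [openGraph_adj, Function.update_of_ne hab.1.1.1]
      exact ⟨⟨hab.1.1.2, hab.1.2⟩, hab.2⟩

open Classical in
theorem cluster_update_false {e : Sym2 V} :
    cluster D (Function.update ω e false) A = cluster (D.erase e) ω A := by
  have : openGraph D (Function.update ω e false) = openGraph (D.erase e) ω := by
    ext a b
    by_cases hf : s(a, b) = e
    · simp [openGraph_adj, hf]
    · simp [openGraph_adj, hf]
  simp only [cluster, this]

open Classical in
/-- Revealing the coins at the boundary of the explored set one at a time: a potential `Φ` that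
dominates `F` and does not increase on average dominates the mean of `F` at the cluster. -/
theorem integral_cluster_le (p : Sym2 V → unitInterval) (F : Finset V → ℝ)
    (Φ : Finset V → Finset (Sym2 V) → ℝ) (A₀ : Finset V) (D₀ : Finset (Sym2 V))
    (hF : ∀ A D, F A ≤ Φ A D)
    (hΦ : ∀ A D i j, A₀ ⊆ A → D ⊆ D₀ → i ∈ A → j ∉ A → s(i, j) ∈ D →
      (p s(i, j) : ℝ) * Φ (insert j A) (D.erase s(i, j)) +
        (1 - (p s(i, j) : ℝ)) * Φ A (D.erase s(i, j)) ≤ Φ A D) :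
    ∫ ω, F (cluster D₀ ω A₀) ∂coins p ≤ Φ A₀ D₀ := by
  -- Induction on the number of unrevealed pairs. Only coins in `D` influence the cluster, so the
  -- full measure can be kept throughout.
  suffices H : ∀ (k : ℕ) (A : Finset V) (D : Finset (Sym2 V)), D.card = k → A₀ ⊆ A → D ⊆ D₀ →
      ∫ ω, F (cluster D ω A) ∂coins p ≤ Φ A D from H _ _ _ rfl subset_rfl subset_rfl
  intro k
  induction k with
  | zero =>
    intro A D hk _ _
    rw [Finset.card_eq_zero] at hk
    subst hk
    simpa [cluster_eq_self (A := A) (D := ∅)] using hF A ∅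
  | succ k ih =>
    intro A D hk hA hD
    by_cases h : ∃ i ∈ A, ∃ j ∉ A, s(i, j) ∈ D
    · obtain ⟨i, hi, j, hj, he⟩ := h
      have hk' : (D.erase s(i, j)).card = k := by rw [Finset.card_erase_of_mem he, hk]; rfl
      have hD' : D.erase s(i, j) ⊆ D₀ := (Finset.erase_subset _ _).trans hD
      rw [integral_coins_eq p s(i, j)]
      simp only [cluster_update_true hi hj he, cluster_update_false]
      refine le_trans ?_ (hΦ A D i j hA hD hi hj he)
      have h1 := (p s(i, j)).2.1
      have h2 : (0 : ℝ) ≤ 1 - p s(i, j) := sub_nonneg.2 (p s(i, j)).2.2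
      gcongr
      · exact ih _ _ hk' (hA.trans (Finset.subset_insert _ _)) hD'
      · exact ih _ _ hk' hA hD'
    · push Not at h
      simpa [cluster_eq_self h] using hF A D

/-! ### Potentials built from the mean weight of unexplored pairs. -/

open Classical in
/-- The mean weight of the unexplored pairs in `D` at `i`, when the vertex `k` has weight `u k`. -/
noncomputable def pairWeight (p : Sym2 V → unitInterval) (u : V → ℝ) (D : Finset (Sym2 V)) (i : V) : ℝ :=
  ∑ k, if s(i, k) ∈ D then (p s(i, k) : ℝ) * u k else 0

theorem pairWeight_nonneg (p : Sym2 V → unitInterval) {u : V → ℝ} (hu : ∀ k, 0 ≤ u k)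
    (D : Finset (Sym2 V)) (i : V) : 0 ≤ pairWeight p u D i :=
  Finset.sum_nonneg fun k _ => by
    split_ifs
    · exact mul_nonneg (p _).2.1 (hu k)
    · exact le_rfl

theorem pairWeight_mono (p : Sym2 V → unitInterval) {u : V → ℝ} (hu : ∀ k, 0 ≤ u k)
    {D D' : Finset (Sym2 V)} (h : D ⊆ D') (i : V) : pairWeight p u D i ≤ pairWeight p u D' i :=
  Finset.sum_le_sum fun k _ => by
    have := mul_nonneg (p s(i, k)).2.1 (hu k)
    split_ifs with h1 h2 h2
    · exact le_rfl
    · exact absurd (h h1) h2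
    · exact this
    · exact le_rfl

theorem pairWeight_le_sum (p : Sym2 V → unitInterval) {u : V → ℝ} (hu : ∀ k, 0 ≤ u k)
    (D : Finset (Sym2 V)) (i : V) : pairWeight p u D i ≤ ∑ k, (p s(i, k) : ℝ) * u k :=
  Finset.sum_le_sum fun k _ => by
    have := mul_nonneg (p s(i, k)).2.1 (hu k)
    split_ifs
    · exact le_rfl
    · exact this

open Classical in
theorem pairWeight_erase_add_le (p : Sym2 V → unitInterval) {u : V → ℝ} (hu : ∀ k, 0 ≤ u k)
    {i j : V} (he : s(i, j) ∈ D) :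
    pairWeight p u (D.erase s(i, j)) i + (p s(i, j) : ℝ) * u j ≤ pairWeight p u D i := by
  unfold pairWeight
  rw [← Finset.add_sum_erase _ _ (Finset.mem_univ j),
    ← Finset.add_sum_erase _ (fun k => if s(i, k) ∈ D then (p s(i, k) : ℝ) * u k else 0)
      (Finset.mem_univ j)]
  simp only [Finset.mem_erase, ne_eq, not_true_eq_false, false_and, if_false, he, if_true, zero_add]
  rw [add_comm]
  gcongr with k hk
  have := mul_nonneg (p s(i, k)).2.1 (hu k)
  split_ifs with h1 h2 h2
  · exact le_rfl
  · exact absurd h1.2 h2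
  · exact this
  · exact le_rfl

-- Revealing a boundary pair frees at least its own mean weight `p * u j`; this pays for the chance
-- that `j` joins the cluster.
open Classical in
theorem sum_pairWeight_erase_add_le (p : Sym2 V → unitInterval) {u : V → ℝ} (hu : ∀ k, 0 ≤ u k)
    {i j : V} (hi : i ∈ A) (he : s(i, j) ∈ D) :
    ∑ a ∈ A, pairWeight p u (D.erase s(i, j)) a + (p s(i, j) : ℝ) * u j ≤
      ∑ a ∈ A, pairWeight p u D a := by
  rw [← Finset.add_sum_erase _ _ hi, ← Finset.add_sum_erase _ (fun a => pairWeight p u D a) hi]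
  have h1 := pairWeight_erase_add_le p hu he
  have h2 := Finset.sum_le_sum fun a (_ : a ∈ A.erase i) =>
    pairWeight_mono p hu (Finset.erase_subset s(i, j) D) a
  linarith

open Classical in
/-- A subcritical growth condition bounds the exponential moment of the cluster size. -/
theorem integral_exp_card_cluster_le (p : Sym2 V → unitInterval) (t : ℝ) (y : V → ℝ)
    (hy : ∀ k, 0 ≤ y k) (A₀ : Finset V) (D₀ : Finset (Sym2 V))
    (h : ∀ e ∈ D₀, ∀ j ∈ e, j ∉ A₀ →
      t + pairWeight p (fun k => Real.exp (y k) - 1) D₀ j ≤ y j) :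
    ∫ ω, Real.exp (t * (cluster D₀ ω A₀).card) ∂coins p ≤
      Real.exp (t * A₀.card +
        ∑ i ∈ A₀, pairWeight p (fun k => Real.exp (y k) - 1) D₀ i) := by
  obtain ⟨u, hu_def⟩ : ∃ u : V → ℝ, u = fun k => Real.exp (y k) - 1 := ⟨_, rfl⟩
  have hu : ∀ k, 0 ≤ u k := fun k => by
    have := Real.add_one_le_exp (y k)
    rw [hu_def]
    linarith [hy k]
  rw [← hu_def] at h ⊢
  refine integral_cluster_le p (fun A => Real.exp (t * A.card))
    (fun A D => Real.exp (t * A.card + ∑ i ∈ A, pairWeight p u D i)) A₀ D₀ ?_ ?_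
  · intro A D
    have := Finset.sum_nonneg fun i (_ : i ∈ A) => pairWeight_nonneg p hu D i
    exact Real.exp_le_exp.2 (by linarith)
  · intro A D i j hA hD hi hj he
    have h1 := sum_pairWeight_erase_add_le (A := A) p hu hi he
    have h2 := h _ (hD he) j (by simp) fun hj' => hj (hA hj')
    have h3 := pairWeight_mono p hu ((Finset.erase_subset s(i, j) D).trans hD) j
    set q : ℝ := (p s(i, j) : ℝ)
    set S := ∑ a ∈ A, pairWeight p u (D.erase s(i, j)) a
    have hq : 0 ≤ q := (p s(i, j)).2.1
    rw [Finset.card_insert_of_notMem hj, Finset.sum_insert hj]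
    push_cast
    -- If the pair is open, `j` raises the exponent by at most `y j`. The mean factor `1 - q + q *
    -- exp (y j) = 1 + q * u j` is at most `exp (q * u j)`, which the revealed pair pays for.
    calc q * Real.exp (t * (A.card + 1) + (pairWeight p u (D.erase s(i, j)) j + S)) +
          (1 - q) * Real.exp (t * A.card + S)
        ≤ q * Real.exp (t * A.card + S + y j) + (1 - q) * Real.exp (t * A.card + S) := by
          refine add_le_add_left (mul_le_mul_of_nonneg_left (Real.exp_le_exp.2 ?_) hq) _
          linarith
      _ = Real.exp (t * A.card + S) * (q * u j + 1) := by
          rw [Real.exp_add _ (y j)]; simp only [hu_def]; ring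
      _ ≤ Real.exp (t * A.card + S) * Real.exp (q * u j) := by
          gcongr; exact Real.add_one_le_exp _
      _ = Real.exp (t * A.card + S + q * u j) := by rw [← Real.exp_add]
      _ ≤ _ := Real.exp_le_exp.2 (by linarith)

open Classical in
/-- A subcritical growth condition bounds the probability of a connection to `z`. -/
theorem measureReal_mem_cluster_le (p : Sym2 V → unitInterval) (u : V → ℝ) (hu : ∀ k, 0 ≤ u k)
    (z : V) (A₀ : Finset V) (hz : z ∉ A₀) (D₀ : Finset (Sym2 V))
    (h : ∀ j, (if j = z then 1 else 0) + pairWeight p u D₀ j ≤ u j) :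
    (coins p).real {ω | z ∈ cluster D₀ ω A₀} ≤ ∑ i ∈ A₀, pairWeight p u D₀ i := by
  -- The linear analogue: `u` is a supersolution of the mean-offspring equation with source at `z`,
  -- so it dominates the expected number of paths to `z`.
  have H := integral_cluster_le p (fun A => if z ∈ A then 1 else 0)
    (fun A D => (if z ∈ A then 1 else 0) + ∑ i ∈ A, pairWeight p u D i) A₀ D₀ ?_ ?_
  · rw [← integral_indicator_one (MeasurableSet.of_discrete)]
    simpa [hz, Set.indicator_apply] using H
  · intro A D
    have := Finset.sum_nonneg fun i (_ : i ∈ A) => pairWeight_nonneg p hu D i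
    linarith
  · intro A D i j hA hD hi hj he
    have h1 := sum_pairWeight_erase_add_le (A := A) p hu hi he
    have h2 := h j
    have h3 := pairWeight_mono p hu ((Finset.erase_subset s(i, j) D).trans hD) j
    have hq : (0 : ℝ) ≤ p s(i, j) := (p s(i, j)).2.1
    set q : ℝ := (p s(i, j) : ℝ)
    set S := ∑ a ∈ A, pairWeight p u (D.erase s(i, j)) a
    have h4 : ((if z ∈ insert j A then 1 else 0) : ℝ) =
        (if z ∈ A then 1 else 0) + (if j = z then 1 else 0) := by
      by_cases hzj : j = z
      · subst hzj; simp [hj]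
      · simp [hzj, Ne.symm hzj]
    rw [Finset.sum_insert hj, h4]
    have h5 : q * ((if j = z then 1 else 0) + pairWeight p u (D.erase s(i, j)) j) ≤ q * u j :=
      mul_le_mul_of_nonneg_left (by linarith) hq
    linarith

end Cluster

/-! ### Subcritical rank-one graphs and hubs. -/

section RankOne

variable {V : Type*} [Fintype V] {p : Sym2 V → unitInterval} {w : V → ℝ} {c ρ : ℝ}

open Classical in
/-- In a subcritical rank-one graph, `v` and `z` are connected with probability `O(c w_v w_z)`. -/
theorem measureReal_reachable_le (hc : 0 ≤ c) (hw : ∀ k, 0 ≤ w k)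
    (hp : ∀ i j, (p s(i, j) : ℝ) ≤ c * w i * w j) (hρ : c * ∑ k, w k ^ 2 ≤ ρ) (hρ1 : ρ < 1)
    {v z : V} (hvz : v ≠ z) :
    (coins p).real {ω | z ∈ cluster Finset.univ ω {v}} ≤ c * w v * w z / (1 - ρ) := by
  have h1ρ : 0 < 1 - ρ := by linarith
  -- With `u = κ w + 1_z` the rank-one bound closes up when `κ ρ + c w_z = κ`; this `κ` is the
  -- solution.
  obtain ⟨κ, hκ⟩ : ∃ κ, κ = c * w z / (1 - ρ) := ⟨_, rfl⟩
  have hκ0 : 0 ≤ κ := by rw [hκ]; exact div_nonneg (mul_nonneg hc (hw z)) h1ρ.le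
  have hκ' : κ * ρ + c * w z = κ := by
    rw [hκ]; field_simp; ring
  set u : V → ℝ := fun k => κ * w k + if k = z then 1 else 0 with hu
  have hu0 : ∀ k, 0 ≤ u k := fun k => by
    have := mul_nonneg hκ0 (hw k)
    simp only [hu]; split_ifs <;> linarith
  have hgrow : ∀ j, pairWeight p u Finset.univ j ≤ κ * w j := fun j => by
    calc pairWeight p u Finset.univ j ≤ ∑ k, (p s(j, k) : ℝ) * u k := pairWeight_le_sum p hu0 _ _
      _ ≤ ∑ k, c * w j * w k * u k := by
          gcongr with k
          · exact hu0 k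
          · exact hp j k
      _ = w j * (κ * (c * ∑ k, w k ^ 2) + c * w z) := by
          simp only [hu, mul_add, Finset.sum_add_distrib, mul_ite, mul_one, mul_zero,
            Finset.sum_ite_eq', Finset.mem_univ, if_true, Finset.mul_sum]
          congr 1
          · exact Finset.sum_congr rfl fun k _ => by ring
          · ring
      _ ≤ w j * (κ * ρ + c * w z) := by
          have := hw j
          gcongr
      _ = κ * w j := by rw [hκ']; ring
  have h := measureReal_mem_cluster_le p u hu0 z {v} (by simpa using hvz.symm) Finset.univ
    fun j => by have := hgrow j; simp only [hu]; linarith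
  rw [Finset.sum_singleton] at h
  refine (h.trans (hgrow v)).trans (le_of_eq ?_)
  rw [hκ]; ring

open Classical in
/-- The pairs that avoid the hubs in `H` other than `u`. -/
noncomputable def hubFreePairs (H : Finset V) (u : V) : Finset (Sym2 V) :=
  {e | ∀ x ∈ e, x = u ∨ x ∉ H}

open Classical in
theorem mem_hubFreePairs {H : Finset V} {u : V} {e : Sym2 V} :
    e ∈ hubFreePairs H u ↔ ∀ x ∈ e, x = u ∨ x ∉ H := by
  simp [hubFreePairs]

theorem exp_sub_one_le {a x : ℝ} (h0 : 0 ≤ x) (hxa : x ≤ a) (ha : a ≤ 1) :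
    Real.exp x - 1 ≤ x * (1 + a) := by
  have h := (abs_le.1 (Real.abs_exp_sub_one_sub_id_le (x := x)
    (by rw [abs_of_nonneg h0]; linarith))).2
  nlinarith

-- For light `k`, `exp (s w_k) - 1` is at most `(1 + a) s w_k`, so `s w` nearly solves the linear
-- growth equation, with slack `s (1 - ρ) w_j`. Since `w_j ≥ 1`, this slack covers the rate `s (1 -
-- ρ)`.
open Classical in
theorem integral_exp_card_hubFree_le (hc : 0 ≤ c) (hw : ∀ k, 1 ≤ w k)
    (hp : ∀ i j, (p s(i, j) : ℝ) ≤ c * w i * w j) {s a : ℝ} (hs : 0 ≤ s)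
    (ha0 : 0 ≤ a) (ha1 : a ≤ 1)
    (hρ : c * (∑ k, w k ^ 2) * (1 + a) ≤ ρ) (hρ1 : ρ ≤ 1)
    (H : Finset V) (hH : ∀ k ∉ H, s * w k ≤ a) (u : V) :
    ∫ ω, Real.exp (s * (1 - ρ) * (cluster (hubFreePairs H u) ω {u}).card) ∂coins p ≤
      Real.exp (s * w u) := by
  have hw0 : ∀ k, 0 ≤ w k := fun k => zero_le_one.trans (hw k)
  -- The root is already explored and other hubs lie in no admissible pair. None of them is ever
  -- newly found, so they may have weight zero, which removes the only vertices where `s * w k` can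
  -- exceed `a`.
  set y : V → ℝ := fun k => if k = u ∨ k ∈ H then 0 else s * w k with hy
  have hy0 : ∀ k, 0 ≤ y k := fun k => by
    simp only [hy]; split_ifs
    · exact le_rfl
    · exact mul_nonneg hs (hw0 k)
  have hye : ∀ k, Real.exp (y k) - 1 ≤ s * w k * (1 + a) := fun k => by
    have := mul_nonneg hs (hw0 k)
    simp only [hy]; split_ifs with h
    · rw [Real.exp_zero, sub_self]; positivity
    · exact exp_sub_one_le this (hH k fun hk => h (.inr hk)) ha1
  have hu0 : ∀ k, 0 ≤ Real.exp (y k) - 1 := fun k => by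
    have := Real.add_one_le_exp (y k)
    linarith [hy0 k]
  have hgrow : ∀ j, s * (1 - ρ) +
      pairWeight p (fun k => Real.exp (y k) - 1) (hubFreePairs H u) j ≤ s * w j := fun j => by
    have h1 : pairWeight p (fun k => Real.exp (y k) - 1) (hubFreePairs H u) j ≤
        s * w j * ρ := by
      calc _ ≤ ∑ k, (p s(j, k) : ℝ) * (Real.exp (y k) - 1) := pairWeight_le_sum p hu0 _ _
        _ ≤ ∑ k, c * w j * w k * (s * w k * (1 + a)) := by
            refine Finset.sum_le_sum fun k _ => mul_le_mul (hp j k) (hye k) (hu0 k) ?_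
            exact mul_nonneg (mul_nonneg hc (hw0 j)) (hw0 k)
        _ = s * w j * (c * (∑ k, w k ^ 2) * (1 + a)) := by
            simp only [Finset.mul_sum, Finset.sum_mul]
            exact Finset.sum_congr rfl fun k _ => by ring
        _ ≤ _ := mul_le_mul_of_nonneg_left hρ (mul_nonneg hs (hw0 j))
    have h2 : 0 ≤ s * (1 - ρ) * (w j - 1) :=
      mul_nonneg (mul_nonneg hs (by linarith)) (by linarith [hw j])
    linarith
  refine (integral_exp_card_cluster_le p (s * (1 - ρ)) y hy0 {u} (hubFreePairs H u) ?_).trans ?_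
  · intro e he j hj hju
    rw [Finset.mem_singleton] at hju
    have hjH : j ∉ H := (mem_hubFreePairs.1 he j hj).resolve_left hju
    have : y j = s * w j := by simp [hy, hju, hjH]
    rw [this]
    exact hgrow j
  · rw [Finset.sum_singleton, Finset.card_singleton]
    exact Real.exp_le_exp.2 (by simpa using hgrow u)

open Classical in
theorem measureReal_card_hubFree_le (hc : 0 ≤ c) (hw : ∀ k, 1 ≤ w k)
    (hp : ∀ i j, (p s(i, j) : ℝ) ≤ c * w i * w j) {s a : ℝ} (hs : 0 ≤ s)
    (ha0 : 0 ≤ a) (ha1 : a ≤ 1)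
    (hρ : c * (∑ k, w k ^ 2) * (1 + a) ≤ ρ) (hρ1 : ρ ≤ 1)
    (H : Finset V) (hH : ∀ k ∉ H, s * w k ≤ a) (u : V) (K : ℝ) :
    (coins p).real {ω | K ≤ ((cluster (hubFreePairs H u) ω {u}).card : ℝ)} ≤
      Real.exp (s * w u - s * (1 - ρ) * K) := by
  have h1 := integral_exp_card_hubFree_le hc hw hp hs ha0 ha1 hρ hρ1 H hH u
  have hM := mul_meas_ge_le_integral_of_nonneg (μ := coins p)
    (f := fun ω => Real.exp (s * (1 - ρ) * (cluster (hubFreePairs H u) ω {u}).card))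
    (Filter.Eventually.of_forall fun _ => (Real.exp_pos _).le) .of_finite
    (Real.exp (s * (1 - ρ) * K))
  have hsub : (coins p).real {ω | K ≤ ((cluster (hubFreePairs H u) ω {u}).card : ℝ)} ≤
      (coins p).real {ω | Real.exp (s * (1 - ρ) * K) ≤
        Real.exp (s * (1 - ρ) * (cluster (hubFreePairs H u) ω {u}).card)} := by
    refine measureReal_mono fun ω hω => Real.exp_le_exp.2 ?_
    exact mul_le_mul_of_nonneg_left hω (mul_nonneg hs (by linarith))
  rw [Real.exp_sub, le_div_iff₀ (Real.exp_pos _), mul_comm]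
  exact (mul_le_mul_of_nonneg_left hsub (Real.exp_pos _).le).trans (hM.trans h1)

/-- A cluster either connects two hubs or is the hub-free cluster of one of its vertices. -/
theorem connects_hubs_or_subset_hubFree (H : Finset V) (ω : Sym2 V → Bool) (v : V) :
    (∃ x ∈ H, ∃ z ∈ H, x ≠ z ∧ z ∈ cluster Finset.univ ω {x}) ∨
      ∃ u, cluster Finset.univ ω {v} ⊆ cluster (hubFreePairs H u) ω {u} := by
  refine or_iff_not_imp_left.2 fun hno => ?_
  push Not at hno
  have key : ∀ u, (openGraph Finset.univ ω).Reachable u v →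
      (∀ x, (openGraph Finset.univ ω).Reachable u x → x = u ∨ x ∉ H) →
      cluster Finset.univ ω {v} ⊆ cluster (hubFreePairs H u) ω {u} := by
    intro u huv hu
    have hmem : ∀ {x}, (openGraph Finset.univ ω).Reachable u x →
        x ∈ cluster (hubFreePairs H u) ω {u} := by
      intro x hx
      rw [SimpleGraph.reachable_iff_reflTransGen] at hx
      induction hx with
      | refl => exact subset_cluster (Finset.mem_singleton_self u)
      | @tail a b hua hab ih =>
        rw [← SimpleGraph.reachable_iff_reflTransGen] at hua
        refine mem_cluster_of_adj ih ?_
        have hab' := openGraph_adj.1 hab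
        refine openGraph_adj.2 ⟨⟨mem_hubFreePairs.2 fun x hx => ?_, hab'.1.2⟩, hab'.2⟩
        rcases Sym2.mem_iff.1 hx with rfl | rfl
        · exact hu _ hua
        · exact hu _ (hua.trans hab.reachable)
    intro x hx
    obtain ⟨v', hv', hvx⟩ := mem_cluster.1 hx
    rw [Finset.mem_singleton] at hv'
    subst hv'
    exact hmem (huv.trans hvx)
  -- Root the exploration at the hub of the cluster if there is one, and at `v` otherwise.
  by_cases hv : ∃ u ∈ H, (openGraph Finset.univ ω).Reachable u v
  · obtain ⟨u, huH, huv⟩ := hv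
    refine ⟨u, key u huv fun x hx => ?_⟩
    by_contra! hcon
    exact hno u huH x hcon.2 hcon.1.symm
      (mem_cluster.2 ⟨u, Finset.mem_singleton_self u, hx⟩)
  · push Not at hv
    exact ⟨v, key v (.refl v) fun x hx => .inr fun hxH => hv x hxH hx.symm⟩

theorem measureReal_exists_card_cluster_le (hc : 0 ≤ c) (hw : ∀ k, 1 ≤ w k)
    (hp : ∀ i j, (p s(i, j) : ℝ) ≤ c * w i * w j) {s a ρ₀ M : ℝ} (hs : 0 ≤ s)
    (ha0 : 0 ≤ a) (ha1 : a ≤ 1) (hM : ∀ k, w k ≤ M) (hρ₀ : c * (∑ k, w k ^ 2) ≤ ρ₀)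
    (hρ₀1 : ρ₀ < 1) (hρ : ρ₀ * (1 + a) ≤ ρ) (hρ1 : ρ ≤ 1)
    (H : Finset V) (hH : ∀ k ∉ H, s * w k ≤ a) (K : ℝ) :
    (coins p).real {ω | ∃ v, K ≤ ((cluster Finset.univ ω {v}).card : ℝ)} ≤
      (H.card : ℝ) ^ 2 * (c * M ^ 2 / (1 - ρ₀)) +
        Fintype.card V * Real.exp (s * M - s * (1 - ρ) * K) := by
  classical
  have hw0 : ∀ k, 0 ≤ w k := fun k => zero_le_one.trans (hw k)
  have h1ρ : 0 < 1 - ρ₀ := by linarith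
  have hsub : {ω | ∃ v, K ≤ ((cluster Finset.univ ω {v}).card : ℝ)} ⊆
      (⋃ q ∈ H.offDiag, {ω | q.2 ∈ cluster Finset.univ ω {q.1}}) ∪
        ⋃ u ∈ (Finset.univ : Finset V),
          {ω | K ≤ ((cluster (hubFreePairs H u) ω {u}).card : ℝ)} := by
    rintro ω ⟨v, hv⟩
    rcases connects_hubs_or_subset_hubFree H ω v with ⟨x, hx, z, hz, hxz, h⟩ | ⟨u, hu⟩
    · refine .inl (Set.mem_iUnion₂.2 ⟨(x, z), ?_, h⟩)
      simp [hx, hz, hxz]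
    · refine .inr (Set.mem_iUnion₂.2 ⟨u, Finset.mem_univ u, hv.trans ?_⟩)
      exact_mod_cast Finset.card_le_card hu
  refine (measureReal_mono hsub).trans ((measureReal_union_le _ _).trans (add_le_add ?_ ?_))
  · refine (measureReal_biUnion_finset_le _ _).trans ?_
    have hb : ∀ q ∈ H.offDiag, (coins p).real {ω | q.2 ∈ cluster Finset.univ ω {q.1}} ≤
        c * M ^ 2 / (1 - ρ₀) := by
      intro q hq
      refine (measureReal_reachable_le hc hw0 hp hρ₀ hρ₀1 (Finset.mem_offDiag.1 hq).2.2).trans ?_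
      have h1 : w q.1 * w q.2 ≤ M * M :=
        mul_le_mul (hM _) (hM _) (hw0 _) ((hw0 _).trans (hM q.1))
      have h2 : c * w q.1 * w q.2 ≤ c * M ^ 2 := by
        rw [mul_assoc, sq]; exact mul_le_mul_of_nonneg_left h1 hc
      gcongr
    refine (Finset.sum_le_card_nsmul _ _ _ hb).trans ?_
    rw [nsmul_eq_mul]
    refine mul_le_mul_of_nonneg_right ?_ (by positivity)
    have : H.offDiag.card ≤ H.card ^ 2 := by rw [Finset.offDiag_card, sq]; omega
    exact_mod_cast this
  · refine (measureReal_biUnion_finset_le _ _).trans ?_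
    refine (Finset.sum_le_card_nsmul _ _ (Real.exp (s * M - s * (1 - ρ) * K))
      fun u _ => ?_).trans ?_
    · refine (measureReal_card_hubFree_le hc hw hp hs ha0 ha1
        ((mul_le_mul_of_nonneg_right hρ₀ (by linarith)).trans hρ) hρ1 H hH u K).trans ?_
      have := mul_le_mul_of_nonneg_left (hM u) hs
      exact Real.exp_le_exp.2 (by linarith)
    · rw [nsmul_eq_mul, Finset.card_univ]

end RankOne

/-! ### The Chung–Lu weights and the choice of parameters. -/

section Weights

open Finset

theorem sum_rpow_neg_le {β : ℝ} (h0 : 0 ≤ β) (h1 : β < 1) (n : ℕ) :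
    ∑ i ∈ range n, ((i : ℝ) + 1) ^ (-β) ≤ (n : ℝ) ^ (1 - β) / (1 - β) := by
  have hβ : 0 < 1 - β := by linarith
  induction n with
  | zero => simp [Real.zero_rpow hβ.ne']
  | succ n ih =>
    rw [sum_range_succ]
    push_cast
    have hn : (0 : ℝ) < n + 1 := by positivity
    -- Bernoulli's inequality for the exponent `1 - β ≤ 1` bounds one summand by the increment of
    -- `x^(1-β)/(1-β)`.
    have hB := rpow_one_add_le_one_add_mul_self (s := -(1 / ((n : ℝ) + 1))) (by
      rw [neg_le_neg_iff, div_le_one hn]; linarith [n.cast_nonneg (α := ℝ)]) hβ.le (by linarith)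
    have h2 : ((n : ℝ) + 1) ^ (1 - β) * (1 + -(1 / ((n : ℝ) + 1))) ^ (1 - β) =
        (n : ℝ) ^ (1 - β) := by
      rw [← Real.mul_rpow hn.le]
      · congr 1; field_simp; ring
      · have : 1 / ((n : ℝ) + 1) ≤ 1 := by
          rw [div_le_one hn]; linarith [n.cast_nonneg (α := ℝ)]
        linarith
    have h3 : ((n : ℝ) + 1) ^ (1 - β) = ((n : ℝ) + 1) ^ (-β) * (n + 1) := by
      rw [← Real.rpow_add_one hn.ne']; congr 1; ring
    have h4 := mul_le_mul_of_nonneg_left hB (Real.rpow_nonneg hn.le (1 - β))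
    rw [h2] at h4
    have h5 : ((n : ℝ) + 1) ^ (1 - β) * (1 + (1 - β) * -(1 / ((n : ℝ) + 1))) =
        ((n : ℝ) + 1) ^ (1 - β) - (1 - β) * ((n : ℝ) + 1) ^ (-β) := by
      rw [h3]; field_simp; ring
    rw [h5] at h4
    rw [le_div_iff₀ hβ] at ih ⊢
    linarith

variable {γ : ℝ}

theorem thetaC_eq (hγ : 3 < γ) : thetaC γ = 1 - 2 * (1 / (γ - 1)) := by
  have hα : 2 * (1 / (γ - 1)) < 1 := by
    rw [mul_one_div, div_lt_one (by linarith)]; linarith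
  have h : ∫ x in (0 : ℝ)..1, psi γ x ^ 2 = 1 / (1 - 2 * (1 / (γ - 1))) := by
    have : ∫ x in (0 : ℝ)..1, psi γ x ^ 2 = ∫ x in (0 : ℝ)..1, x ^ (-(2 * (1 / (γ - 1)))) := by
      refine intervalIntegral.integral_congr fun x hx => ?_
      rw [Set.uIcc_of_le zero_le_one] at hx
      simp only [psi]
      rw [← Real.rpow_mul_natCast hx.1]
      congr 1; push_cast; ring
    rw [this, integral_rpow (.inl (by linarith)), Real.one_rpow, Real.zero_rpow (by linarith)]
    congr 1 <;> ring
  rw [thetaC, h, one_div_one_div]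

variable {n : ℕ}

theorem label_pos (i : Fin n) : 0 < label n i := by
  have : (0 : ℝ) < n := by exact_mod_cast i.pos
  unfold label; positivity

theorem label_le_one (i : Fin n) : label n i ≤ 1 := by
  have : (0 : ℝ) < n := by exact_mod_cast i.pos
  rw [label, div_le_one this]
  exact_mod_cast i.isLt

theorem psi_label (i : Fin n) :
    psi γ (label n i) = (n : ℝ) ^ (1 / (γ - 1)) * ((i : ℝ) + 1) ^ (-(1 / (γ - 1))) := by
  have hn : (0 : ℝ) < n := by exact_mod_cast i.pos
  rw [psi, label, Real.div_rpow (by positivity) hn.le, Real.rpow_neg hn.le, div_inv_eq_mul,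
    mul_comm]

theorem one_le_psi_label (hγ : 1 < γ) (i : Fin n) : 1 ≤ psi γ (label n i) := by
  have : 0 < 1 / (γ - 1) := one_div_pos.2 (by linarith)
  exact Real.one_le_rpow_of_pos_of_le_one_of_nonpos (label_pos i) (label_le_one i) (by linarith)

theorem psi_label_le (hγ : 1 < γ) (i : Fin n) : psi γ (label n i) ≤ (n : ℝ) ^ (1 / (γ - 1)) := by
  have : 0 < 1 / (γ - 1) := one_div_pos.2 (by linarith)
  rw [psi_label]
  refine mul_le_of_le_one_right (by positivity) ?_
  exact Real.rpow_le_one_of_one_le_of_nonpos (by simp) (by linarith)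

/-- The sum is a lower Riemann sum of the decreasing function `ψ²`, so subcriticality holds for
every `n` with no error term. -/
theorem sum_psi_label_sq_le (hγ : 3 < γ) (n : ℕ) :
    ∑ i, psi γ (label n i) ^ 2 ≤ n / thetaC γ := by
  rcases n.eq_zero_or_pos with rfl | hn
  · simp
  have hn' : (0 : ℝ) < n := by exact_mod_cast hn
  have hα0 : 0 < 1 / (γ - 1) := one_div_pos.2 (by linarith)
  have hα : 2 * (1 / (γ - 1)) < 1 := by
    rw [mul_one_div, div_lt_one (by linarith)]; linarith
  rw [thetaC_eq hγ]
  set β := 2 * (1 / (γ - 1)) with hβ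
  have h1 : ∀ i : Fin n, psi γ (label n i) ^ 2 = (n : ℝ) ^ β * ((i : ℝ) + 1) ^ (-β) := by
    intro i
    rw [psi_label, mul_pow, ← Real.rpow_mul_natCast hn'.le, ← Real.rpow_mul_natCast (by positivity)]
    congr 2 <;> (push_cast; rw [hβ]; ring)
  simp only [h1]
  rw [← mul_sum, Fin.sum_univ_eq_sum_range (fun i : ℕ => ((i : ℝ) + 1) ^ (-β)) n]
  calc (n : ℝ) ^ β * ∑ i ∈ range n, ((i : ℝ) + 1) ^ (-β)
      ≤ (n : ℝ) ^ β * ((n : ℝ) ^ (1 - β) / (1 - β)) := by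
        gcongr
        exact sum_rpow_neg_le (by positivity) hα n
    _ = n / (1 - β) := by
        rw [← mul_div_assoc, ← Real.rpow_add hn', add_sub_cancel, Real.rpow_one]

theorem edgeProb_le {θ : ℝ} (hθ : 0 ≤ θ) (i j : Fin n) :
    (edgeProb γ θ n s(i, j) : ℝ) ≤ θ / n * psi γ (label n i) * psi γ (label n j) := by
  have h0 : 0 ≤ kernel γ θ (label n i) (label n j) / n :=
    div_nonneg (mul_nonneg (mul_nonneg hθ (Real.rpow_nonneg (label_pos i).le _))
      (Real.rpow_nonneg (label_pos j).le _)) n.cast_nonneg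
  have h : (edgeProb γ θ n s(i, j) : ℝ) =
      max 0 (min 1 (kernel γ θ (label n i) (label n j) / n)) := rfl
  rw [h]
  refine (max_le h0 (min_le_right _ _)).trans (le_of_eq ?_)
  unfold kernel; ring

theorem graph_eq_openGraph (ω : Sym2 (Fin n) → Bool) : graph ω = openGraph Finset.univ ω := by
  simp [graph, openGraph]

theorem clusterSize_eq_card (ω : Sym2 (Fin n) → Bool) (v : Fin n) :
    clusterSize (graph ω) v = (cluster Finset.univ ω {v}).card := by
  rw [clusterSize, graph_eq_openGraph, ← Set.ncard_coe_finset]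
  congr 1
  ext w
  simp [mem_cluster]

theorem measureReal_maxClusterSize_le {θ : ℝ} (hγ : 3 < γ) (hθ₀ : 0 ≤ θ) (hθ : θ < thetaC γ)
    (hn : 0 < n) {ε : ℝ} :
    (coinMeasure γ θ n).real {ω | 6 / (1 - θ / thetaC γ) * (n : ℝ) ^ (1 / (γ - 1)) ≤
        (maxClusterSize (graph ω) : ℝ)} ≤
      θ / (1 - θ / thetaC γ) * (n : ℝ) ^ (2 * ε + 2 * (1 / (γ - 1)) - 1) +
        n * Real.exp (-(1 - θ / thetaC γ) * (n : ℝ) ^ (ε * (1 / (γ - 1)))) := by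
  have hn' : (0 : ℝ) < n := by exact_mod_cast hn
  have hα0 : 0 < 1 / (γ - 1) := one_div_pos.2 (by linarith)
  have hθc : 0 < thetaC γ := hθ₀.trans_lt hθ
  set α := 1 / (γ - 1) with hα
  set ρ₀ := θ / thetaC γ with hρ₀
  have hρ₀0 : 0 ≤ ρ₀ := div_nonneg hθ₀ hθc.le
  have hρ₀1 : ρ₀ < 1 := (div_lt_one hθc).2 hθ
  set M : ℝ := (n : ℝ) ^ α with hM
  have hMpos : 0 < M := Real.rpow_pos_of_pos hn' _
  -- `a` keeps `ρ₀ (1 + a) ≤ (1 + ρ₀) / 2 < 1`. A vertex outside `H` has weight at most `M / n^(ε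
  -- α)`, so `s` is the largest rate for which this bound gives `s w ≤ a`.
  set a : ℝ := (1 - ρ₀) / 2 with ha
  set s : ℝ := a * (n : ℝ) ^ (ε * α) / M with hs
  set H : Finset (Fin n) := {i | ((i : ℕ) + 1 : ℝ) ≤ (n : ℝ) ^ ε} with hH
  have hHcard : (H.card : ℝ) ≤ (n : ℝ) ^ ε := by
    have hpos : 0 ≤ (n : ℝ) ^ ε := Real.rpow_nonneg hn'.le _
    refine le_trans ?_ (Nat.floor_le hpos)
    have : H.card ≤ (range ⌊(n : ℝ) ^ ε⌋₊).card := by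
      refine card_le_card_of_injOn (fun i => (i : ℕ)) (fun i hi => ?_) Fin.val_injective.injOn
      have hi' : ((i : ℕ) + 1 : ℝ) ≤ (n : ℝ) ^ ε := by simpa [hH] using hi
      have : (i : ℕ) + 1 ≤ ⌊(n : ℝ) ^ ε⌋₊ := Nat.le_floor (by exact_mod_cast hi')
      simpa using this
    rw [card_range] at this
    exact_mod_cast this
  have hsM : s * M = a * (n : ℝ) ^ (ε * α) := by rw [hs]; field_simp
  have ha0 : 0 ≤ a := by rw [ha]; linarith
  have hs0 : 0 ≤ s := by rw [hs]; positivity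
  have hlight : ∀ k ∉ H, s * psi γ (label n k) ≤ a := by
    intro k hk
    have hk' : (n : ℝ) ^ ε ≤ (k : ℝ) + 1 := by
      have : ¬ ((k : ℕ) + 1 : ℝ) ≤ (n : ℝ) ^ ε := by simpa [hH] using hk
      exact (not_le.1 this).le
    rw [psi_label, ← hα, ← hM, ← mul_assoc, hsM, mul_assoc]
    refine mul_le_of_le_one_right ha0 ?_
    have hk0 : (0 : ℝ) < (k : ℝ) + 1 := by positivity
    rw [Real.rpow_neg hk0.le, ← div_eq_mul_inv, div_le_one (Real.rpow_pos_of_pos hk0 _),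
      Real.rpow_mul hn'.le]
    exact Real.rpow_le_rpow (Real.rpow_nonneg hn'.le _) hk' hα0.le
  have hmean : θ / n * ∑ k, psi γ (label n k) ^ 2 ≤ ρ₀ := by
    calc θ / n * ∑ k, psi γ (label n k) ^ 2 ≤ θ / n * (n / thetaC γ) := by
          gcongr; exact sum_psi_label_sq_le hγ n
      _ = ρ₀ := by rw [hρ₀]; field_simp
  have hbound := measureReal_exists_card_cluster_le (p := edgeProb γ θ n) (c := θ / n)
    (ρ := (1 + ρ₀) / 2) (M := M)
    (div_nonneg hθ₀ hn'.le) (one_le_psi_label (γ := γ) (by linarith)) (edgeProb_le hθ₀) hs0 ha0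
    (by rw [ha]; linarith) (psi_label_le (by linarith)) hmean hρ₀1 (by rw [ha]; nlinarith)
    (by linarith) H hlight (6 / (1 - ρ₀) * M)
  have hset : {ω : Sym2 (Fin n) → Bool | 6 / (1 - ρ₀) * M ≤ (maxClusterSize (graph ω) : ℝ)} ⊆
      {ω | ∃ v, 6 / (1 - ρ₀) * M ≤ ((cluster Finset.univ ω {v}).card : ℝ)} := by
    intro ω hω
    have : Nonempty (Fin n) := ⟨⟨0, hn⟩⟩
    obtain ⟨v, -, hv⟩ := exists_mem_eq_sup univ univ_nonempty fun v => clusterSize (graph ω) v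
    refine ⟨v, ?_⟩
    rw [← clusterSize_eq_card, ← hv]
    exact hω
  refine (measureReal_mono (μ := coins (edgeProb γ θ n)) hset).trans (hbound.trans ?_)
  refine add_le_add ?_ ?_
  · calc (H.card : ℝ) ^ 2 * (θ / n * M ^ 2 / (1 - ρ₀))
        ≤ ((n : ℝ) ^ ε) ^ 2 * (θ / n * M ^ 2 / (1 - ρ₀)) := by
          have : 0 ≤ 1 - ρ₀ := by linarith
          gcongr
      _ = θ / (1 - ρ₀) * (((n : ℝ) ^ ε) ^ 2 * M ^ 2 / n) := by ring
      _ = _ := by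
          rw [Real.rpow_sub_one hn'.ne', Real.rpow_add hn', hM, ← Real.rpow_mul_natCast hn'.le,
            ← Real.rpow_mul_natCast hn'.le]
          push_cast
          rw [mul_comm ε 2, mul_comm α 2]
  · rw [Fintype.card_fin]
    refine mul_le_mul_of_nonneg_left (Real.exp_le_exp.2 (le_of_eq ?_)) hn'.le
    have h1 : (1 : ℝ) - ρ₀ ≠ 0 := by linarith
    -- The constant `6` makes the Markov gain `3 s M`. After the root's cost `s M` the exponent is
    -- `-2 s M = -(1 - ρ₀) n^(ε α)`, which beats the factor `n`.
    have h2 : s * (1 - (1 + ρ₀) / 2) * (6 / (1 - ρ₀) * M) = 3 * (s * M) := by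
      field_simp; ring
    rw [h2, hsM, ha]; ring

end Weights

/-! ### Passage to the limit. -/

open Filter Topology in
theorem tendsto_measure_maxClusterSize {γ θ : ℝ} (hγ : 3 < γ) (hθ₀ : 0 ≤ θ)
    (hθ : θ < thetaC γ) :
    Tendsto (fun n : ℕ => coinMeasure γ θ n
      {ω | 6 / (1 - θ / thetaC γ) * (n : ℝ) ^ (1 / (γ - 1)) ≤ (maxClusterSize (graph ω) : ℝ)})
      atTop (𝓝 0) := by
  have hα0 : 0 < 1 / (γ - 1) := one_div_pos.2 (by linarith)
  have hα : 2 * (1 / (γ - 1)) < 1 := by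
    rw [mul_one_div, div_lt_one (by linarith)]; linarith
  have hρ : 0 < 1 - θ / thetaC γ := sub_pos.2 ((div_lt_one (hθ₀.trans_lt hθ)).2 hθ)
  -- This makes `2ε + 2α - 1 = -(1 - 2α)/2`, which is negative because `γ > 3`.
  obtain ⟨ε, hε⟩ : ∃ ε, ε = (1 - 2 * (1 / (γ - 1))) / 4 := ⟨_, rfl⟩
  have hη : 0 < ε * (1 / (γ - 1)) := mul_pos (by linarith) hα0
  have hnat := tendsto_natCast_atTop_atTop (R := ℝ)
  have h1 : Tendsto (fun n : ℕ => (n : ℝ) ^ (2 * ε + 2 * (1 / (γ - 1)) - 1)) atTop (𝓝 0) := by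
    have := (tendsto_rpow_neg_atTop (y := 1 - 2 * ε - 2 * (1 / (γ - 1)))
      (by linarith)).comp hnat
    refine this.congr fun n => ?_
    simp only [Function.comp_apply]
    congr 1; ring
  have h2 : Tendsto (fun n : ℕ =>
      (n : ℝ) * Real.exp (-(1 - θ / thetaC γ) * (n : ℝ) ^ (ε * (1 / (γ - 1))))) atTop (𝓝 0) := by
    -- Substitute `x = n^(ε α)`, so that the factor `n` becomes a fixed power of `x`.
    have := ((tendsto_rpow_mul_exp_neg_mul_atTop_nhds_zero (1 / (ε * (1 / (γ - 1)))) _ hρ).comp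
      (tendsto_rpow_atTop hη)).comp hnat
    refine this.congr fun n => ?_
    simp only [Function.comp_apply]
    rw [← Real.rpow_mul n.cast_nonneg, mul_one_div_cancel hη.ne', Real.rpow_one]
  have h3 := (h1.const_mul (θ / (1 - θ / thetaC γ))).add h2
  rw [mul_zero, add_zero] at h3
  have h4 := ENNReal.tendsto_ofReal h3
  rw [ENNReal.ofReal_zero] at h4
  refine tendsto_of_tendsto_of_tendsto_of_le_of_le' tendsto_const_nhds h4
    (Eventually.of_forall fun _ => zero_le) ?_
  filter_upwards [eventually_gt_atTop 0] with n hn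
  have : IsProbabilityMeasure (coinMeasure γ θ n) :=
    inferInstanceAs (IsProbabilityMeasure (coins (edgeProb γ θ n)))
  rw [← ofReal_measureReal]
  exact ENNReal.ofReal_le_ofReal (measureReal_maxClusterSize_le hγ hθ₀ hθ hn)

end ChungLu

theorem theorem4 (γ θ : ℝ) (hγ : 3 < γ) (hθ₀ : 0 ≤ θ) (hθ : θ < ChungLu.thetaC γ) :
    ∃ C : ℝ, Filter.Tendsto
      (fun n : ℕ => ChungLu.coinMeasure γ θ n
        {ω | C * (n : ℝ) ^ (1 / (γ - 1)) ≤ (ChungLu.maxClusterSize (ChungLu.graph ω) : ℝ)})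
      Filter.atTop (nhds 0) :=
  ⟨_, ChungLu.tendsto_measure_maxClusterSize hγ hθ₀ hθ⟩
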